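/- For integers $n \ge k \ge 1$ let $K(n,k)$ be the Kneser graph, whose vertices are the $k$-element subsets of an $n$-element set, two of them being adjacent when they are disjoint. For a finite graph $G$ and a set $S$ of vertices, let $c(G\setminus S)$ be the number of connected components of the graph obtained by deleting $S$; $S$ is a vertex cut if $c(G\setminus S)\ge 2$. The toughness of $G$ is $t(G)=\min_S \frac{|S|}{c(G\setminus S)}$, where $S$ ranges over all vertex cuts of $G$. Put $$q(k)=\frac{2}{\ln 2}k^2+\left(2-\frac{3}{\ln 2}\right)k+\frac{1}{\ln 2}.$$ (a) For every integer $k\ge 3$, $$q(k)\ \ge\ \frac{2^{\frac1{k-1}}(2k)-1}{2^{\frac1{k-1}}-1}.$$ (b) Let $k\ge 5$ and $n\ge q(k)$ be integers. Then $t(K(n,k))=\frac nk-1$, and every vertex cut $S$ of $K(n,k)$ with $\frac{|S|}{c(K(n,k)\setminus S)}=t(K(n,k))$ is the complement of a maximum independent set of $K(n,k)$. (c) Let $k\ge 3$ and $n> q(k)$ be integers. Then $t(K(n,k))=\frac nk-1$, and every vertex cut $S$ of $K(n,k)$ with $\frac{|S|}{c(K(n,k)\setminus S)}=\frac nk-1$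 is the complement of a maximum independent set of $K(n,k)$. -/

import Mathlib

namespace Toughness

/-- The Kneser graph `K(n,k)`: the vertices are the `k`-element subsets of an `n`-element set, and
two distinct vertices are adjacent when they are disjoint (for `k ≥ 1`, disjointness already
implies distinctness). -/
def kneserGraph (n k : ℕ) : SimpleGraph {s : Finset (Fin n) // s.card = k} where
  Adj s t := s ≠ t ∧ Disjoint s.1 t.1
  symm := ⟨fun _ _ h => ⟨h.1.symm, h.2.symm⟩⟩
  loopless := ⟨fun _ h => h.1 rfl⟩

/-- `c(G \ S)`: the number of connected components of the graph that remains after deleting the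
vertices in `S`. -/
noncomputable def numComponents {V : Type*} (G : SimpleGraph V) (S : Finset V) : ℕ :=
  Nat.card (G.induce ((S : Set V)ᶜ)).ConnectedComponent

/-- `S` is a vertex cut of `G`: deleting `S` leaves a disconnected graph, that is, a graph with at
least two components. -/
def IsVertexCut {V : Type*} (G : SimpleGraph V) (S : Finset V) : Prop :=
  2 ≤ numComponents G S

/-- The ratio `|S| / c(G \ S)`. -/
noncomputable def cutRatio {V : Type*} (G : SimpleGraph V) (S : Finset V) : ℝ :=
  (S.card : ℝ) / (numComponents G S : ℝ)

/-- The toughness `t(G)` of a finite graph, the minimum of `|S| / c(G \ S)` over all vertex cuts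
`S`. The infimum is a minimum as soon as there is a vertex cut, see `isLeast_toughness`; for a
graph without vertex cuts the value is `0` by convention. -/
noncomputable def toughness {V : Type*} (G : SimpleGraph V) : ℝ :=
  sInf {r : ℝ | ∃ S : Finset V, IsVertexCut G S ∧ cutRatio G S = r}

theorem isLeast_toughness {V : Type*} [Finite V] (G : SimpleGraph V)
    (h : ∃ S : Finset V, IsVertexCut G S) :
    IsLeast {r : ℝ | ∃ S : Finset V, IsVertexCut G S ∧ cutRatio G S = r} (toughness G) := by
  have hfin : {r : ℝ | ∃ S : Finset V, IsVertexCut G S ∧ cutRatio G S = r}.Finite :=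
    (Set.finite_range (cutRatio G)).subset (by rintro r ⟨S, -, rfl⟩; exact ⟨S, rfl⟩)
  obtain ⟨S, hS⟩ := h
  have hne : {r : ℝ | ∃ S : Finset V, IsVertexCut G S ∧ cutRatio G S = r}.Nonempty :=
    ⟨_, S, hS, rfl⟩
  exact ⟨hne.csInf_mem hfin, fun r hr => csInf_le hfin.bddBelow hr⟩

/-- `(2 / ln 2) k² + (2 - 3 / ln 2) k + 1 / ln 2`. -/
noncomputable def quadBound (k : ℕ) : ℝ :=
  2 / Real.log 2 * (k : ℝ) ^ 2 + (2 - 3 / Real.log 2) * (k : ℝ) + 1 / Real.log 2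

/-- `(2^{1/(k-1)} · 2k - 1) / (2^{1/(k-1)} - 1)`. -/
noncomputable def rootBound (k : ℕ) : ℝ :=
  ((2 : ℝ) ^ (1 / ((k : ℝ) - 1)) * (2 * (k : ℝ)) - 1) / ((2 : ℝ) ^ (1 / ((k : ℝ) - 1)) - 1)

end Toughness

namespace Toughness

open Finset
open scoped FinsetFamily

/-! ### Cross-intersecting families and stability of large intersecting families. -/

section SetFamilies

variable {n k : ℕ}

/-! Let W be the complement of a cut, c its number of components, α = C(n-1,k-1) the size of a star
and β = C(n-2,k-2). As C(n,k)·k = nα, the bound n/k - 1 on the ratio says c(n-k) + k|W| ≤ nα.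
Members of W in different components are not adjacent, so they meet: the components are pairwise
cross-intersecting. Kruskal-Katona (`card_add_choose_le_of_cross`) then leaves two cases
(`card_le_three_stars_or`).

If |W| ≤ 3α, the inequality is strict unless c(n-k) ≥ α(n-3k). In that case every transversal of the
components is a large intersecting family, hence lies in a star (`exists_center_of_intersecting`).
Exchanging one member of a transversal cannot move the centre, so W lies in a star. If instead all
components but one have fewer than β members together, then c ≤ β and |W| ≤ kα + β, and the
inequality is strict again.

Inside a star c ≤ |W| ≤ α, which gives the inequality, with equality only for the full star. All
this needs only n ≥ 2k² + k, which follows from the quadratic hypothesis when k ≥ 3. -/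

theorem card_filter_superset (T : Finset (Fin n)) (hT : #T ≤ k) :
    #{s ∈ powersetCard k (univ : Finset (Fin n)) | T ⊆ s} = (n - #T).choose (k - #T) := by
  have h : #(powersetCard (k - #T) Tᶜ) = (n - #T).choose (k - #T) := by
    rw [card_powersetCard, card_compl, Fintype.card_fin]
  rw [← h]
  refine card_bij' (fun s _ => s \ T) (fun s _ => s ∪ T) ?_ ?_ ?_ ?_
  · intro s hs
    simp only [mem_filter, mem_powersetCard, subset_univ, true_and] at hs ⊢
    refine ⟨fun x hx => by simpa using (mem_sdiff.1 hx).2, ?_⟩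
    rw [card_sdiff_of_subset hs.2, hs.1]
  · intro s hs
    simp only [mem_filter, mem_powersetCard, subset_univ, true_and] at hs ⊢
    have hd : Disjoint s T := disjoint_left.2 fun x hx => by simpa using hs.1 hx
    refine ⟨?_, subset_union_right⟩
    rw [card_union_of_disjoint hd, hs.2]
    omega
  · intro s hs
    exact sdiff_union_of_subset (mem_filter.1 hs).2
  · intro s hs
    have hd : Disjoint s T := disjoint_left.2 fun x hx => by
      simpa using (mem_powersetCard.1 hs).1 hx
    exact union_sdiff_cancel_right hd

theorem card_le_of_forall_superset {𝒜 : Finset (Finset (Fin n))}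
    (h𝒜 : (𝒜 : Set (Finset (Fin n))).Sized k) {T : Finset (Fin n)} (hT : #T ≤ k)
    (h : ∀ s ∈ 𝒜, T ⊆ s) : #𝒜 ≤ (n - #T).choose (k - #T) := by
  rw [← card_filter_superset T hT]
  refine card_le_card fun s hs => ?_
  simpa using ⟨h𝒜 hs, h s hs⟩

theorem card_filter_mem_star (hk : 1 ≤ k) (x : Fin n) :
    #{s ∈ powersetCard k (univ : Finset (Fin n)) | x ∈ s} = (n - 1).choose (k - 1) := by
  simpa using card_filter_superset (k := k) {x} (by simpa using hk)

theorem card_le_star {𝒜 : Finset (Finset (Fin n))}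
    (h𝒜 : (𝒜 : Set (Finset (Fin n))).Sized k) (hk : 1 ≤ k) {x : Fin n}
    (h : ∀ s ∈ 𝒜, x ∈ s) : #𝒜 ≤ (n - 1).choose (k - 1) := by
  simpa using card_le_of_forall_superset h𝒜 (T := {x}) (by simpa using hk) (by simpa using h)

theorem card_le_star_pair {𝒜 : Finset (Finset (Fin n))}
    (h𝒜 : (𝒜 : Set (Finset (Fin n))).Sized k) (hk : 2 ≤ k) {x y : Fin n} (hxy : x ≠ y)
    (h : ∀ s ∈ 𝒜, x ∈ s ∧ y ∈ s) : #𝒜 ≤ (n - 2).choose (k - 2) := by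
  have hc : #({x, y} : Finset (Fin n)) = 2 := card_pair hxy
  have := card_le_of_forall_superset h𝒜 (T := {x, y}) (by omega) fun s hs => by
    simpa [insert_subset_iff] using h s hs
  rwa [hc] at this

/-- A family of `k`-sets all of which meet a fixed set `t` splits into stars with centres in `t`. -/
theorem card_le_sum_stars {𝒜 : Finset (Finset (Fin n))} {t : Finset (Fin n)}
    (h : ∀ s ∈ 𝒜, ¬ Disjoint s t) : #𝒜 ≤ ∑ y ∈ t, #{s ∈ 𝒜 | y ∈ s} := by
  refine (card_le_card fun s hs => ?_).trans card_biUnion_le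
  obtain ⟨y, hys, hyt⟩ := not_disjoint_iff.1 (h s hs)
  exact mem_biUnion.2 ⟨y, hyt, mem_filter.2 ⟨hs, hys⟩⟩

/-- Cross-intersecting families: if `𝒜` is as large as the family of all sets containing `j` given
points, then `ℬ` is at most as large as the family of all sets meeting these points. -/
theorem card_add_choose_le_of_cross {p r j : ℕ} {𝒜 ℬ : Finset (Finset (Fin n))}
    (h𝒜 : (𝒜 : Set (Finset (Fin n))).Sized p) (hℬ : (ℬ : Set (Finset (Fin n))).Sized r)
    (hpr : p + r ≤ n) (hj : j ≤ p) (hcross : ∀ s ∈ 𝒜, ∀ t ∈ ℬ, ¬ Disjoint s t)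
    (hcard : (n - j).choose (p - j) ≤ #𝒜) : #ℬ + (n - j).choose r ≤ n.choose r := by
  -- The iterated shadow of the complements consists of the r-sets disjoint from some member of 𝒜.
  -- None of them is in ℬ, and Kruskal-Katona makes them numerous.
  have hdisj : Disjoint ℬ (∂^[n - p - r] 𝒜ᶜˢ) := disjoint_right.2 fun B hB hBB => by
    simp only [mem_shadow_iterate_iff_exists_sdiff, mem_compls] at hB
    obtain ⟨C, hC, hBC, _⟩ := hB
    exact hcross _ hC _ hBB (disjoint_of_subset_right hBC disjoint_compl_left)
  have hsz : (𝒜ᶜˢ : Set (Finset (Fin n))).Sized (n - p) := by simpa using h𝒜.compls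
  have hc : (n - j).choose (n - p) ≤ #𝒜ᶜˢ := by
    rwa [card_compls, Nat.choose_symm_of_eq_add (show n - j = n - p + (p - j) by omega)]
  have kk := kruskal_katona_lovasz_form (i := n - p - r) (by omega) (by omega) (by omega) hsz hc
  rw [show n - p - (n - p - r) = r by omega] at kk
  calc #ℬ + (n - j).choose r ≤ #ℬ + #(∂^[n - p - r] 𝒜ᶜˢ) := by omega
    _ = #(ℬ ∪ ∂^[n - p - r] 𝒜ᶜˢ) := (card_union_of_disjoint hdisj).symm
    _ ≤ (Fintype.card (Fin n)).choose r := by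
      refine Set.Sized.card_le ?_
      rw [coe_union, Set.sized_union]
      refine ⟨hℬ, ?_⟩
      have := hsz.shadow_iterate (k := n - p - r)
      rwa [show n - p - (n - p - r) = r by omega] at this
    _ = n.choose r := by rw [Fintype.card_fin]

/-! ### Binomial identities -/

theorem choose_mul_eq (hk : 1 ≤ k) (hkn : 1 ≤ n) :
    n.choose k * k = n * (n - 1).choose (k - 1) := by
  obtain ⟨m, rfl⟩ : ∃ m, n = m + 1 := ⟨n - 1, by omega⟩
  obtain ⟨l, rfl⟩ : ∃ l, k = l + 1 := ⟨k - 1, by omega⟩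
  exact (Nat.add_one_mul_choose_eq m l).symm

theorem choose_star_pair_mul (hk : 2 ≤ k) (hkn : 2 ≤ n) :
    (n - 2).choose (k - 2) * (n - 1) = (k - 1) * (n - 1).choose (k - 1) := by
  have := choose_mul_eq (n := n - 1) (k := k - 1) (by omega) (by omega)
  rw [show n - 1 - 1 = n - 2 by omega, show k - 1 - 1 = k - 2 by omega] at this
  linarith

theorem choose_below_star_mul (hk : 2 ≤ k) (hkn : k ≤ n) :
    (n - 1).choose (k - 2) * (n - k + 1) = (k - 1) * (n - 1).choose (k - 1) := by
  have := Nat.choose_succ_right_eq (n - 1) (k - 2)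
  rw [show k - 2 + 1 = k - 1 by omega, show n - 1 - (k - 2) = n - k + 1 by omega] at this
  linarith

theorem choose_eq_star_add (hk : 1 ≤ k) (hn : 1 ≤ n) :
    n.choose k = (n - 1).choose (k - 1) + (n - 1).choose k := by
  obtain ⟨m, rfl⟩ : ∃ m, n = m + 1 := ⟨n - 1, by omega⟩
  obtain ⟨l, rfl⟩ : ∃ l, k = l + 1 := ⟨k - 1, by omega⟩
  exact Nat.choose_succ_succ m l

theorem choose_star_pair_le : (n - 2).choose (k - 2) ≤ (n - 1).choose (k - 2) :=
  Nat.choose_le_choose _ (by omega)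

theorem star_pos (hkn : k ≤ n) : 0 < (n - 1).choose (k - 1) :=
  Nat.choose_pos (by omega)

/-- Since β(n-1) = (k-1)α, failure would give (n-3k)(n-1) ≤ (k²-1)(n-k), impossible for such n. -/
theorem lt_of_star_mul_le {c : ℕ} (hk : 2 ≤ k) (hn : 2 * k ^ 2 + k ≤ n)
    (hcard : (n - 1).choose (k - 1) * (n - 3 * k) ≤ c * (n - k)) :
    (k + 1) * (n - 2).choose (k - 2) < c := by
  have hkk : 2 * k ≤ k ^ 2 := by nlinarith
  have hα := star_pos (n := n) (k := k) (by omega)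
  have hβ := choose_star_pair_mul (n := n) (k := k) hk (by omega)
  by_contra! h1
  generalize (n - 1).choose (k - 1) = α at *
  generalize (n - 2).choose (k - 2) = β at *
  have h2 : α * ((n - 3 * k) * (n - 1)) ≤ α * ((k + 1) * (k - 1) * (n - k)) := by
    calc α * ((n - 3 * k) * (n - 1)) = α * (n - 3 * k) * (n - 1) := by ring
      _ ≤ (k + 1) * β * (n - k) * (n - 1) :=
        Nat.mul_le_mul_right _ (hcard.trans (Nat.mul_le_mul_right _ h1))
      _ = β * (n - 1) * ((k + 1) * (n - k)) := by ring
      _ = α * ((k + 1) * (k - 1) * (n - k)) := by rw [hβ]; ring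
  have h3 := Nat.le_of_mul_le_mul_left h2 hα
  zify [show 3 * k ≤ n by omega, show k ≤ n by omega, show 1 ≤ k by omega,
    show 1 ≤ n by omega] at h3 hn hk
  nlinarith [mul_nonneg (sub_nonneg.2 hn) (show (0 : ℤ) ≤ n by positivity)]

/-- A large intersecting family is contained in a star. -/
theorem exists_center_of_intersecting {ℱ : Finset (Finset (Fin n))} (hk : 2 ≤ k)
    (hn : 2 * k ^ 2 + k ≤ n) (hℱ : (ℱ : Set (Finset (Fin n))).Sized k)
    (hint : ∀ s ∈ ℱ, ∀ t ∈ ℱ, ¬ Disjoint s t)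
    (hcard : (n - 1).choose (k - 1) * (n - 3 * k) ≤ #ℱ * (n - k)) :
    ∃ x, ∀ s ∈ ℱ, x ∈ s := by
  have hkk : 2 * k ≤ k ^ 2 := by nlinarith
  have hα := star_pos (n := n) (k := k) (by omega)
  have hγ := choose_below_star_mul (n := n) (k := k) hk (by omega)
  have hβγ := choose_star_pair_le (n := n) (k := k)
  have hN : n.choose (k - 1) =
      (n - 1).choose (k - 2) + ((n - 2).choose (k - 2) + (n - 2).choose (k - 1)) := by
    rw [choose_eq_star_add (k := k - 1) (by omega) (by omega),
      choose_eq_star_add (n := n - 1) (k := k - 1) (by omega) (by omega)]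
    congr 2
  have hpos : 0 < #ℱ := by
    by_contra h0
    have : #ℱ = 0 := by omega
    rw [this, zero_mul] at hcard
    have := Nat.mul_pos hα (show 0 < n - 3 * k by omega)
    omega
  obtain ⟨A, hA⟩ := card_pos.1 hpos
  -- All of ℱ meets the k-set A, so some point of A is popular by averaging; it will be the centre.
  obtain ⟨x, hxA, hx⟩ : ∃ x ∈ A, #ℱ ≤ #{s ∈ ℱ | x ∈ s} * k := by
    have h1 : #ℱ ≤ ∑ y ∈ A, #{s ∈ ℱ | y ∈ s} := card_le_sum_stars fun s hs => hint s hs A hA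
    by_contra! hlt
    have h2 : ∑ y ∈ A, #{s ∈ ℱ | y ∈ s} * k < ∑ y ∈ A, #ℱ :=
      sum_lt_sum_of_nonempty (card_pos.1 (by rw [hℱ hA]; omega)) hlt
    rw [sum_const, ← sum_mul, hℱ hA, smul_eq_mul, mul_comm k] at h2
    have := Nat.mul_le_mul_right k h1
    omega
  set 𝒳 := {s ∈ ℱ | x ∈ s} with h𝒳
  set 𝒴 := {s ∈ ℱ | x ∉ s} with h𝒴
  have hsum : #𝒳 + #𝒴 = #ℱ := card_filter_add_card_filter_not _
  have hmeet : ∀ B ∈ 𝒴, #𝒳 ≤ k * (n - 2).choose (k - 2) := fun B hB => by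
    have hB' := mem_filter.1 hB
    refine (card_le_sum_stars (t := B)
      fun s hs => hint s (mem_filter.1 hs).1 B hB'.1).trans ?_
    rw [← hℱ hB'.1, ← smul_eq_mul]
    refine sum_le_card_nsmul _ _ _ fun y hy => ?_
    rw [hℱ hB'.1]
    refine card_le_star_pair (x := x) (y := y) (fun s hs => ?_) hk
      (fun h => hB'.2 (h ▸ hy)) fun s hs => ?_
    · exact hℱ (mem_filter.1 (mem_filter.1 hs).1).1
    · exact ⟨(mem_filter.1 (mem_filter.1 hs).1).2, (mem_filter.1 hs).2⟩
  refine ⟨x, fun B hB => ?_⟩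
  by_contra hxB
  have hD := hmeet B (mem_filter.2 ⟨hB, hxB⟩)
  -- Otherwise the link of x, which cross-intersects 𝒴, has at most C(n,k-1) - C(n-2,k-1) ≤
  -- 2·C(n-1,k-2) members, too few for a popular x.
  have hY : #𝒴 < (n - 2).choose (k - 2) := by
    by_contra! hge
    have hl : #(𝒳.image (·.erase x)) = #𝒳 := card_image_of_injOn fun s hs t ht hst => by
      have hs' := (mem_filter.1 hs).2
      have ht' := (mem_filter.1 ht).2
      rw [← insert_erase hs', ← insert_erase ht']
      exact congrArg (insert x) hst
    have hcr := card_add_choose_le_of_cross (𝒜 := 𝒴) (ℬ := 𝒳.image (·.erase x)) (p := k)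
      (r := k - 1) (j := 2) (fun s hs => hℱ (mem_filter.1 hs).1)
      (fun s hs => by
        obtain ⟨t, ht, rfl⟩ := mem_image.1 hs
        have := mem_filter.1 ht
        rw [card_erase_of_mem this.2, hℱ this.1])
      (by omega) hk
      (fun s hs t ht => by
        obtain ⟨u, hu, rfl⟩ := mem_image.1 ht
        have hs' := mem_filter.1 hs
        obtain ⟨y, hys, hyu⟩ := not_disjoint_iff.1 (hint s hs'.1 u (mem_filter.1 hu).1)
        refine not_disjoint_iff.2 ⟨y, hys, mem_erase.2 ⟨fun h => hs'.2 (h ▸ hys), hyu⟩⟩)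
      hge
    rw [hl, hN] at hcr
    have hX : #𝒳 ≤ 2 * (n - 1).choose (k - 2) := by omega
    have h1 : #ℱ ≤ 2 * (n - 1).choose (k - 2) * k := hx.trans (Nat.mul_le_mul_right _ hX)
    generalize (n - 1).choose (k - 1) = α at *
    generalize (n - 1).choose (k - 2) = γ at *
    have h2 : α * ((n - 3 * k) * (n - k + 1)) ≤ α * (2 * k * (k - 1) * (n - k)) := by
      calc α * ((n - 3 * k) * (n - k + 1)) = α * (n - 3 * k) * (n - k + 1) := by ring
        _ ≤ 2 * γ * k * (n - k) * (n - k + 1) :=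
          Nat.mul_le_mul_right _ (hcard.trans (Nat.mul_le_mul_right _ h1))
        _ = γ * (n - k + 1) * (2 * k * (n - k)) := by ring
        _ = α * (2 * k * (k - 1) * (n - k)) := by rw [hγ]; ring
    have h3 := Nat.le_of_mul_le_mul_left h2 hα
    zify [show 3 * k ≤ n by omega, show k ≤ n by omega, show 1 ≤ k by omega] at h3 hn hk
    have h4 : (0 : ℤ) ≤ k * (k - 1) := by nlinarith
    nlinarith [mul_nonneg (sub_nonneg.2 hn) (show (0 : ℤ) ≤ n by positivity)]
  have := lt_of_star_mul_le hk hn hcard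
  rw [add_mul] at this
  omega

end SetFamilies

/-! ### Families partitioned into cross-intersecting parts. -/

section Partitions

variable {n k : ℕ}

theorem choose_eq_two_stars (hk : 2 ≤ k) (hn : 2 ≤ n) :
    n.choose k = (n - 1).choose (k - 1) + (n - 2).choose (k - 1) + (n - 2).choose k := by
  rw [choose_eq_star_add (by omega) (by omega),
    choose_eq_star_add (n := n - 1) (k := k) (by omega) (by omega), ← add_assoc]
  congr 2

/-- For a family partitioned into cross-intersecting parts, either all parts but one are small
altogether, or the whole family has at most the size of three stars. -/
theorem card_le_three_stars_or {ι : Type*} [DecidableEq ι] {W : Finset (Finset (Fin n))}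
    (f : Finset (Fin n) → ι) (hk : 2 ≤ k) (hn : 2 * k ≤ n)
    (hW : (W : Set (Finset (Fin n))).Sized k)
    (hf : ∀ s ∈ W, ∀ t ∈ W, f s ≠ f t → ¬ Disjoint s t) :
    #W ≤ 3 * (n - 1).choose (k - 1) ∨
      ∃ i, #{s ∈ W | f s ≠ i} < (n - 2).choose (k - 2) := by
  set α := (n - 1).choose (k - 1) with hα
  have hN := choose_eq_star_add (n := n) (k := k) (by omega) (by omega)
  have cross : ∀ T : Finset ι, α ≤ #{s ∈ W | f s ∈ T} → #{s ∈ W | f s ∉ T} ≤ α := fun T hT => by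
    have := card_add_choose_le_of_cross (𝒜 := {s ∈ W | f s ∈ T}) (ℬ := {s ∈ W | f s ∉ T})
      (p := k) (r := k) (j := 1) (fun s hs => hW (mem_filter.1 hs).1)
      (fun s hs => hW (mem_filter.1 hs).1) (by omega) (by omega)
      (fun s hs t ht => by
        have hs' := mem_filter.1 hs
        have ht' := mem_filter.1 ht
        exact hf s hs'.1 t ht'.1 fun h => ht'.2 (h ▸ hs'.2)) hT
    omega
  by_cases hbig : ∃ i, α ≤ #{s ∈ W | f s = i}
  · obtain ⟨i, hi⟩ := hbig
    by_cases hb : #{s ∈ W | f s ≠ i} < (n - 2).choose (k - 2)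
    · exact Or.inr ⟨i, hb⟩
    left
    have h1 : #{s ∈ W | f s ≠ i} ≤ α := by simpa using cross {i} (by simpa using hi)
    have h2 := card_add_choose_le_of_cross (𝒜 := {s ∈ W | f s ≠ i}) (ℬ := {s ∈ W | f s = i})
      (p := k) (r := k) (j := 2) (fun s hs => hW (mem_filter.1 hs).1)
      (fun s hs => hW (mem_filter.1 hs).1) (by omega) (by omega)
      (fun s hs t ht => by
        have hs' := mem_filter.1 hs
        have ht' := mem_filter.1 ht
        exact hf s hs'.1 t ht'.1 fun h => hs'.2 (h.trans ht'.2)) (by omega)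
    have h3 := choose_eq_two_stars (n := n) (k := k) hk (by omega)
    have h4 : (n - 2).choose (k - 1) ≤ α := Nat.choose_le_choose _ (by omega)
    have h5 : #{s ∈ W | f s = i} + #{s ∈ W | f s ≠ i} = #W := card_filter_add_card_filter_not _
    omega
  · left
    push Not at hbig
    by_contra! hlarge
    -- All parts are smaller than α. A minimal union of parts reaching α has fewer than 2α members,
    -- and what remains has at most α.
    have hne : ∃ m, ∃ T : Finset ι, #T = m ∧ α ≤ #{s ∈ W | f s ∈ T} := by
      refine ⟨_, W.image f, rfl, ?_⟩
      rw [filter_true_of_mem fun s hs => mem_image_of_mem f hs]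
      omega
    classical
    obtain ⟨T, hTm, hT⟩ := Nat.find_spec hne
    have hTne : T.Nonempty := by
      rw [nonempty_iff_ne_empty]
      rintro rfl
      have : 0 < α := star_pos (by omega)
      simp at hT
      omega
    obtain ⟨i, hi⟩ := hTne
    have h1 : #{s ∈ W | f s ∈ T.erase i} < α := by
      by_contra! h
      exact Nat.find_min hne (m := #(T.erase i))
        (by rw [← hTm]; exact card_erase_lt_of_mem hi) ⟨_, rfl, h⟩
    have h2 : #{s ∈ W | f s ∈ T} ≤ #{s ∈ W | f s ∈ T.erase i} + #{s ∈ W | f s = i} := by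
      refine (card_le_card fun s hs => ?_).trans (card_union_le _ _)
      simp only [mem_union, mem_filter, mem_erase] at hs ⊢
      tauto
    have h3 := hbig i
    have h4 := cross T hT
    have h5 : #{s ∈ W | f s ∈ T} + #{s ∈ W | f s ∉ T} = #W := card_filter_add_card_filter_not _
    omega

/-- A family of `k`-sets partitioned into at least two cross-intersecting parts is contained in a
star, or satisfies a strict inequality between its size and the number of parts. -/
theorem exists_center_or_lt {ι : Type*} [DecidableEq ι] {W : Finset (Finset (Fin n))}
    (f : Finset (Fin n) → ι) (hk : 2 ≤ k) (hn : 2 * k ^ 2 + k ≤ n)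
    (hW : (W : Set (Finset (Fin n))).Sized k)
    (hf : ∀ s ∈ W, ∀ t ∈ W, f s ≠ f t → ¬ Disjoint s t) (hc : 2 ≤ #(W.image f)) :
    (∃ x, ∀ s ∈ W, x ∈ s) ∨ #(W.image f) * (n - k) + k * #W < k * n.choose k := by
  have hkk : 2 * k ≤ k ^ 2 := by nlinarith
  have hα := star_pos (n := n) (k := k) (by omega)
  have hβ := choose_star_pair_mul (n := n) (k := k) hk (by omega)
  have hN := choose_mul_eq (n := n) (k := k) (by omega) (by omega)
  rcases card_le_three_stars_or f hk (by omega) hW hf with hm | ⟨i, hi⟩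
  · by_cases hlarge : (n - 1).choose (k - 1) * (n - 3 * k) ≤ #(W.image f) * (n - k)
    · left
      have key : ∀ ℱ ⊆ W, #ℱ = #(W.image f) → Set.InjOn f ℱ → ∃ x, ∀ s ∈ ℱ, x ∈ s :=
        fun ℱ hℱ hcard hinj =>
        exists_center_of_intersecting hk hn (hW.mono (by exact_mod_cast hℱ))
          (fun s hs t ht => by
            by_cases hst : f s = f t
            · rw [← hinj hs ht hst, disjoint_self_iff_empty, ← card_eq_zero, hW (hℱ hs)]
              omega
            · exact hf s (hℱ hs) t (hℱ ht) hst) (hcard ▸ hlarge)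
      obtain ⟨ℱ, hℱ, hinj, himg⟩ : ∃ ℱ ⊆ W, Set.InjOn f ℱ ∧ ℱ.image f = W.image f := by
        obtain ⟨u, hu, hinj, himg⟩ := exists_subset_injOn_image_eq_of_surjOn (f := f)
          (W : Set (Finset (Fin n))) (W.image f) (by rw [coe_image]; exact Set.surjOn_image _ _)
        exact ⟨u, by exact_mod_cast hu, hinj, himg⟩
      have hcard : #ℱ = #(W.image f) := by rw [← himg, card_image_of_injOn hinj]
      obtain ⟨x, hx⟩ := key ℱ hℱ hcard hinj
      refine ⟨x, fun v hv => ?_⟩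
      obtain ⟨u, hu, huv⟩ := mem_image.1 (himg ▸ mem_image_of_mem f hv : f v ∈ ℱ.image f)
      have hvu : v ∉ ℱ.erase u := fun h =>
        (mem_erase.1 h).1 (hinj (mem_erase.1 h).2 hu huv.symm)
      obtain ⟨y, hy⟩ := key (insert v (ℱ.erase u))
        (insert_subset hv ((erase_subset _ _).trans hℱ))
        (by rw [card_insert_of_notMem hvu, card_erase_add_one hu, hcard])
        (by
          rw [coe_insert, Set.injOn_insert (by exact_mod_cast hvu)]
          refine ⟨hinj.mono (by exact_mod_cast erase_subset _ _), ?_⟩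
          rintro ⟨w, hw, hwv⟩
          have hw' := mem_erase.1 (mem_coe.1 hw)
          exact hw'.1 (hinj hw'.2 hu (hwv.trans huv.symm)))
      by_cases hxy : x = y
      · exact hxy ▸ hy v (mem_insert_self _ _)
      exfalso
      have h1 := card_le_star_pair (𝒜 := ℱ.erase u) (x := x) (y := y)
        (fun s hs => hW (hℱ (mem_of_mem_erase hs))) hk hxy
        fun s hs => ⟨hx s (mem_of_mem_erase hs), hy s (mem_insert_of_mem hs)⟩
      have h2 := card_erase_add_one hu
      -- Two distinct centres would put the c - 1 shared members into two stars at once,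
      -- contradicting c > (k+1)β.
      have h3 : #(W.image f) ≤ (n - 2).choose (k - 2) + 1 := by omega
      have h4 := lt_of_star_mul_le hk hn hlarge
      have h5 : 0 < (n - 2).choose (k - 2) := Nat.choose_pos (by omega)
      have h6 := Nat.mul_le_mul_right ((n - 2).choose (k - 2)) (show 3 ≤ k + 1 by omega)
      omega
    · right
      push Not at hlarge
      generalize (n - 1).choose (k - 1) = α at *
      generalize #(W.image f) = c at *
      calc c * (n - k) + k * #W < α * (n - 3 * k) + k * (3 * α) :=
            add_lt_add_of_lt_of_le hlarge (Nat.mul_le_mul_left _ hm)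
        _ = α * (n - 3 * k + 3 * k) := by ring
        _ = n * α := by rw [Nat.sub_add_cancel (by omega), mul_comm]
        _ = k * n.choose k := by rw [mul_comm k, hN]
  · right
    have hcb : #(W.image f) ≤ #{s ∈ W | f s ≠ i} + 1 := by
      have : W.image f ⊆ insert i ({s ∈ W | f s ≠ i}.image f) := fun j hj => by
        obtain ⟨s, hs, rfl⟩ := mem_image.1 hj
        by_cases h : f s = i
        · exact h ▸ mem_insert_self _ _
        · exact mem_insert_of_mem (mem_image_of_mem f (mem_filter.2 ⟨hs, h⟩))
      exact (card_le_card this).trans ((card_insert_le _ _).trans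
        (Nat.add_le_add_right card_image_le 1))
    obtain ⟨t, ht⟩ : {s ∈ W | f s ≠ i}.Nonempty := card_pos.1 (by omega)
    have ht' := mem_filter.1 ht
    -- The dominant part meets a fixed k-set t from another part, so k stars cover it.
    have ha : #{s ∈ W | f s = i} ≤ k * (n - 1).choose (k - 1) := by
      refine (card_le_sum_stars (t := t) fun s hs => ?_).trans ?_
      · have hs' := mem_filter.1 hs
        exact hf s hs'.1 t ht'.1 fun h => ht'.2 (h.symm.trans hs'.2)
      · rw [← hW ht'.1, ← smul_eq_mul]
        refine sum_le_card_nsmul _ _ _ fun y _ => ?_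
        rw [hW ht'.1]
        exact card_le_star (x := y) (fun s hs => hW (mem_filter.1 (mem_filter.1 hs).1).1)
          (by omega) fun s hs => (mem_filter.1 hs).2
    have hsum : #{s ∈ W | f s = i} + #{s ∈ W | f s ≠ i} = #W := card_filter_add_card_filter_not _
    have hm : #W ≤ k * (n - 1).choose (k - 1) + (n - 2).choose (k - 2) := by omega
    have hc' : #(W.image f) ≤ (n - 2).choose (k - 2) := by omega
    generalize (n - 1).choose (k - 1) = α at *
    generalize (n - 2).choose (k - 2) = β at *
    generalize #(W.image f) = c at *
    have hβn : β * n < α * (n - k ^ 2) := by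
      have h1 : (k - 1) * n < (n - k ^ 2) * (n - 1) := by
        zify [show k ^ 2 ≤ n by omega, show 1 ≤ k by omega, show 1 ≤ n by omega]
        zify at hn hk
        nlinarith
      refine Nat.lt_of_mul_lt_mul_right (a := n - 1) ?_
      calc β * n * (n - 1) = β * (n - 1) * n := by ring
        _ = α * ((k - 1) * n) := by rw [hβ]; ring
        _ < α * ((n - k ^ 2) * (n - 1)) := Nat.mul_lt_mul_of_pos_left h1 hα
        _ = α * (n - k ^ 2) * (n - 1) := by ring
    calc c * (n - k) + k * #W ≤ β * (n - k) + k * (k * α + β) :=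
          add_le_add (Nat.mul_le_mul_right _ hc') (Nat.mul_le_mul_left _ hm)
      _ = β * (n - k + k) + α * k ^ 2 := by ring
      _ = β * n + α * k ^ 2 := by rw [Nat.sub_add_cancel (by omega)]
      _ < α * (n - k ^ 2) + α * k ^ 2 := by omega
      _ = n * α := by rw [← mul_add, Nat.sub_add_cancel (by omega), mul_comm]
      _ = k * n.choose k := by rw [mul_comm k, hN]

end Partitions

/-! ### Counting components after deletion. -/

section Components

variable {V : Type*} [Fintype V] [DecidableEq V] {G : SimpleGraph V} {S : Finset V}

theorem card_coe_compl (S : Finset V) : Nat.card ↑((S : Set V)ᶜ) = #Sᶜ := by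
  rw [← coe_compl, Nat.card_eq_card_toFinset, toFinset_coe]

theorem numComponents_le_card_compl (G : SimpleGraph V) (S : Finset V) :
    numComponents G S ≤ #Sᶜ := by
  have h := Nat.card_le_card_of_surjective (G.induce ((S : Set V)ᶜ)).connectedComponentMk
    Quot.mk_surjective
  rwa [card_coe_compl] at h

theorem numComponents_of_isIndepSet (h : G.IsIndepSet (Sᶜ : Finset V)) :
    numComponents G S = #Sᶜ := by
  refine le_antisymm (numComponents_le_card_compl G S) ?_
  have hbot : G.induce ((S : Set V)ᶜ) = ⊥ := by
    ext u v
    simp only [SimpleGraph.comap_adj, Function.Embedding.subtype_apply, SimpleGraph.bot_adj,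
      iff_false]
    intro huv
    rw [coe_compl] at h
    exact h u.2 v.2 huv.ne huv
  have hinj : Function.Injective (G.induce ((S : Set V)ᶜ)).connectedComponentMk := by
    rw [hbot]
    intro u v huv
    exact SimpleGraph.reachable_bot.1 (SimpleGraph.ConnectedComponent.exact huv)
  have := Nat.card_le_card_of_injective _ hinj
  rwa [card_coe_compl] at this

end Components

/-! ### Vertex cuts and toughness of Kneser graphs. -/

section Kneser

variable {n k : ℕ}

theorem isIndepSet_of_center {W : Finset {s : Finset (Fin n) // #s = k}} {x : Fin n}
    (h : ∀ s ∈ W, x ∈ s.1) : (kneserGraph n k).IsIndepSet W :=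
  fun s hs t ht _ hadj => disjoint_left.1 hadj.2 (h s hs) (h t ht)

theorem card_star (hk : 1 ≤ k) (x : Fin n) :
    #{s : {s : Finset (Fin n) // #s = k} | x ∈ s.1} = (n - 1).choose (k - 1) := by
  rw [← card_filter_mem_star hk x]
  refine card_bij (fun s _ => s.1) (fun s hs => ?_) (fun s _ t _ h => Subtype.ext h)
    fun s hs => ?_
  · have := (mem_filter.1 hs).2
    simp [s.2, this]
  · have hs' := mem_filter.1 hs
    exact ⟨⟨s, (mem_powersetCard.1 hs'.1).2⟩, by simpa using hs'.2, rfl⟩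

theorem card_le_of_isIndepSet (hk : 1 ≤ k) (hn : 2 * k ≤ n)
    {T : Finset {s : Finset (Fin n) // #s = k}} (hT : (kneserGraph n k).IsIndepSet T) :
    #T ≤ (n - 1).choose (k - 1) := by
  rw [← card_map (Function.Embedding.subtype _)]
  refine erdos_ko_rado (fun s hs t ht hst => ?_) (fun s hs => ?_) (by omega)
  · obtain ⟨u, hu, rfl⟩ := mem_map.1 (mem_coe.1 hs)
    obtain ⟨v, hv, rfl⟩ := mem_map.1 (mem_coe.1 ht)
    by_cases huv : u = v
    · subst huv
      have := u.2
      simp only [Function.Embedding.subtype_apply, disjoint_self_iff_empty] at hst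
      rw [hst, card_empty] at this
      omega
    · exact hT hu hv huv ⟨huv, hst⟩
  · obtain ⟨u, hu, rfl⟩ := mem_map.1 (mem_coe.1 hs)
    exact u.2

theorem isMaximumIndepSet_of_center (hk : 1 ≤ k) (hn : 2 * k ≤ n)
    {T : Finset {s : Finset (Fin n) // #s = k}} {x : Fin n} (h : ∀ s ∈ T, x ∈ s.1)
    (hT : (n - 1).choose (k - 1) ≤ #T) : (kneserGraph n k).IsMaximumIndepSet T :=
  ⟨isIndepSet_of_center h, fun _ hU => (card_le_of_isIndepSet hk hn hU).trans hT⟩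

/-- The complement of a vertex cut of the Kneser graph is contained in a star, or the cut has more
than `n / k - 1` vertices per component. -/
theorem exists_center_or_lt_of_isVertexCut (hk : 2 ≤ k) (hn : 2 * k ^ 2 + k ≤ n)
    {S : Finset {s : Finset (Fin n) // #s = k}} (hS : IsVertexCut (kneserGraph n k) S) :
    (∃ x, ∀ s ∉ S, x ∈ s.1) ∨ numComponents (kneserGraph n k) S * (n - k) < k * #S := by
  classical
  set H := (kneserGraph n k).induce ((S : Set {s : Finset (Fin n) // #s = k})ᶜ) with hH
  -- The label of a set is its component; `none` is a dummy value never taken on W.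
  let f : Finset (Fin n) → Option H.ConnectedComponent := fun s =>
    if h : ∃ hs : #s = k, (⟨s, hs⟩ : {s : Finset (Fin n) // #s = k}) ∉ S then
      some (H.connectedComponentMk ⟨⟨s, h.1⟩, h.2⟩) else none
  have hf : ∀ (s : {s : Finset (Fin n) // #s = k}) (hs : s ∉ S),
      f s.1 = some (H.connectedComponentMk ⟨s, hs⟩) := fun s hs => dif_pos ⟨s.2, hs⟩
  set W := Sᶜ.map (Function.Embedding.subtype _) with hW
  have hWmem : ∀ s ∈ W, ∃ t ∉ S, t.1 = s := fun s hs => by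
    obtain ⟨t, ht, rfl⟩ := mem_map.1 hs
    exact ⟨t, mem_compl.1 ht, rfl⟩
  have himg : #(W.image f) = numComponents (kneserGraph n k) S := by
    have : W.image f = (univ : Finset H.ConnectedComponent).map Function.Embedding.some := by
      ext o
      simp only [mem_image, mem_map, mem_univ, true_and, Function.Embedding.some_apply]
      constructor
      · rintro ⟨s, hs, rfl⟩
        obtain ⟨t, ht, rfl⟩ := hWmem s hs
        exact ⟨_, (hf t ht).symm⟩
      · rintro ⟨C, rfl⟩
        obtain ⟨v, rfl⟩ := C.exists_rep
        exact ⟨v.1.1, mem_map_of_mem _ (mem_compl.2 v.2), hf v.1 v.2⟩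
    rw [this, card_map, card_univ, ← Nat.card_eq_fintype_card]
    rfl
  have hcard : #S + #W = n.choose k := by
    rw [hW, card_map, card_add_card_compl, Fintype.card_finset_len, Fintype.card_fin]
  have := exists_center_or_lt (W := W) f hk hn
    (fun s hs => by
      obtain ⟨t, _, rfl⟩ := hWmem s hs
      exact t.2)
    (fun s hs t ht hst hdisj => by
      obtain ⟨u, hu, rfl⟩ := hWmem s hs
      obtain ⟨v, hv, rfl⟩ := hWmem t ht
      rw [hf u hu, hf v hv] at hst
      refine hst (congrArg some (SimpleGraph.ConnectedComponent.sound
        (SimpleGraph.Adj.reachable ?_)))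
      exact ⟨fun h => hst (by subst h; rfl), hdisj⟩)
    (by rw [himg]; exact hS)
  rw [himg, ← hcard, mul_add] at this
  refine this.imp (fun ⟨x, hx⟩ => ⟨x, fun s hs => ?_⟩) fun h => by omega
  exact hx s.1 (mem_map_of_mem _ (mem_compl.2 hs))

/-- In the star case both c and |Sᶜ| are at most α, and c(n-k) + k|Sᶜ| = nα forces |Sᶜ| = α. -/
theorem le_of_isVertexCut (hk : 2 ≤ k) (hn : 2 * k ^ 2 + k ≤ n)
    {S : Finset {s : Finset (Fin n) // #s = k}} (hS : IsVertexCut (kneserGraph n k) S) :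
    numComponents (kneserGraph n k) S * (n - k) ≤ k * #S ∧
      (numComponents (kneserGraph n k) S * (n - k) = k * #S →
        (kneserGraph n k).IsMaximumIndepSet Sᶜ) := by
  have hkk : 2 * k ≤ k ^ 2 := by nlinarith
  rcases exists_center_or_lt_of_isVertexCut hk hn hS with ⟨x, hx⟩ | h
  · have hx' : ∀ s ∈ Sᶜ, x ∈ s.1 := fun s hs => hx s (mem_compl.1 hs)
    have hc := numComponents_le_card_compl (kneserGraph n k) S
    have hα := card_le_of_isIndepSet (n := n) (k := k) (by omega) (by omega)
      (isIndepSet_of_center hx')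
    have hN := choose_mul_eq (n := n) (k := k) (by omega) (by omega)
    have hcard : #S + #Sᶜ = n.choose k := by
      rw [card_add_card_compl, Fintype.card_finset_len, Fintype.card_fin]
    have h1 := Nat.mul_le_mul_right (n - k) (hc.trans hα)
    have h2 := Nat.mul_le_mul_left k hα
    have h3 : (n - 1).choose (k - 1) * (n - k) + k * (n - 1).choose (k - 1) =
        k * #S + k * #Sᶜ := by
      rw [mul_comm k ((n - 1).choose _), ← mul_add, Nat.sub_add_cancel (by omega), ← mul_add,
        hcard, mul_comm k, hN, mul_comm]
    refine ⟨by omega, fun h => isMaximumIndepSet_of_center (by omega) (by omega) hx' ?_⟩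
    exact Nat.le_of_mul_le_mul_left (show k * (n - 1).choose (k - 1) ≤ k * #Sᶜ by omega) (by omega)
  · exact ⟨h.le, fun h' => absurd h' h.ne⟩

/-- The vertices outside the star with centre `x`. -/
def starCut (n k : ℕ) (x : Fin n) : Finset {s : Finset (Fin n) // #s = k} :=
  univ.filter fun s => x ∉ s.1

theorem compl_starCut (x : Fin n) :
    (starCut n k x)ᶜ = ({s | x ∈ s.1} : Finset {s : Finset (Fin n) // #s = k}) := by
  ext s
  simp [starCut]

theorem numComponents_starCut (hk : 1 ≤ k) (x : Fin n) :
    numComponents (kneserGraph n k) (starCut n k x) = (n - 1).choose (k - 1) := by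
  rw [numComponents_of_isIndepSet, compl_starCut, card_star hk]
  refine isIndepSet_of_center (x := x) fun s hs => ?_
  simpa [starCut] using hs

theorem card_starCut_add (hk : 1 ≤ k) (x : Fin n) :
    #(starCut n k x) + (n - 1).choose (k - 1) = n.choose k := by
  rw [← card_star hk x, ← compl_starCut, card_add_card_compl, Fintype.card_finset_len,
    Fintype.card_fin]

theorem toughness_kneserGraph (hk : 2 ≤ k) (hn : 2 * k ^ 2 + k ≤ n) :
    toughness (kneserGraph n k) = (n : ℝ) / k - 1 ∧
      ∀ S : Finset {s : Finset (Fin n) // #s = k}, IsVertexCut (kneserGraph n k) S →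
        cutRatio (kneserGraph n k) S = (n : ℝ) / k - 1 →
        (kneserGraph n k).IsMaximumIndepSet Sᶜ := by
  have hkk : 2 * k ≤ k ^ 2 := by nlinarith
  have hk0 : (0 : ℝ) < k := by exact_mod_cast (by omega : 0 < k)
  have hratio : (n : ℝ) / k - 1 = (n - k : ℕ) / (k : ℝ) := by
    rw [Nat.cast_sub (by omega), sub_div, div_self hk0.ne']
  have hc0 : ∀ S, IsVertexCut (kneserGraph n k) S →
      (0 : ℝ) < numComponents (kneserGraph n k) S := fun S hS => by
    exact_mod_cast lt_of_lt_of_le two_pos hS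
  have hcut : IsVertexCut (kneserGraph n k) (starCut n k ⟨0, by omega⟩) ∧
      cutRatio (kneserGraph n k) (starCut n k ⟨0, by omega⟩) = (n : ℝ) / k - 1 := by
    have hα := star_pos (n := n) (k := k) (by omega)
    have hcomp := numComponents_starCut (n := n) (k := k) (by omega) ⟨0, by omega⟩
    have hcard := card_starCut_add (n := n) (k := k) (by omega) ⟨0, by omega⟩
    have hN := choose_mul_eq (n := n) (k := k) (by omega) (by omega)
    constructor
    · rw [IsVertexCut, hcomp]
      have h1 := choose_star_pair_mul (n := n) (k := k) hk (by omega)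
      have h2 : 0 < (n - 2).choose (k - 2) := Nat.choose_pos (by omega)
      -- A star with a single member would give β(n-1) = k-1 with β ≥ 1, contradicting n > k.
      by_contra! h3
      rw [show (n - 1).choose (k - 1) = 1 by omega] at h1
      have := Nat.le_mul_of_pos_left (n - 1) h2
      omega
    · rw [cutRatio, hcomp, hratio,
        div_eq_div_iff (by exact_mod_cast hα.ne') hk0.ne', Nat.cast_sub (by omega)]
      have h1 : ((#(starCut n k ⟨0, by omega⟩) : ℝ) + (n - 1).choose (k - 1)) * k =
          n * (n - 1).choose (k - 1) := by exact_mod_cast hcard ▸ hN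
      linarith
  have hlower : ∀ S, IsVertexCut (kneserGraph n k) S →
      (n : ℝ) / k - 1 ≤ cutRatio (kneserGraph n k) S := fun S hS => by
    rw [hratio, cutRatio, div_le_div_iff₀ hk0 (hc0 S hS), mul_comm, mul_comm (#S : ℝ)]
    exact_mod_cast (le_of_isVertexCut hk hn hS).1
  constructor
  · obtain ⟨⟨S, hS, hSr⟩, hle⟩ := isLeast_toughness (kneserGraph n k) ⟨_, hcut.1⟩
    exact le_antisymm (hle ⟨_, hcut⟩) (hSr ▸ hlower S hS)
  · intro S hS hr
    refine (le_of_isVertexCut hk hn hS).2 ?_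
    rw [hratio, cutRatio, div_eq_div_iff (hc0 S hS).ne' hk0.ne'] at hr
    rw [mul_comm, mul_comm k]
    exact_mod_cast hr.symm

end Kneser

/-! ### Numerical comparison of the bounds on n. -/

section Bounds

open Real

/-- With x = 2^{1/(k-1)} the two sides are 2k + (2k-1)/(x-1) and 2k + (2k-1)(k-1)/ln 2, so 1 + ln
2/(k-1) ≤ x suffices. -/
theorem rootBound_le_quadBound {k : ℕ} (hk : 2 ≤ k) : rootBound k ≤ quadBound k := by
  have hl : 0 < log 2 := log_pos one_lt_two
  have hk' : (2 : ℝ) ≤ k := by exact_mod_cast hk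
  have hk1 : (0 : ℝ) < k - 1 := by linarith
  unfold rootBound quadBound
  set x := (2 : ℝ) ^ (1 / ((k : ℝ) - 1)) with hx
  have hx1 : log 2 / (k - 1) + 1 ≤ x := by
    have := add_one_le_exp (log 2 * (1 / ((k : ℝ) - 1)))
    rwa [← rpow_def_of_pos two_pos, mul_one_div] at this
  have hpos : 0 < log 2 / (k - 1) := by positivity
  rw [div_le_iff₀ (by linarith)]
  have h1 : 1 ≤ (k - 1) / log 2 * (x - 1) := by
    calc (1 : ℝ) = (k - 1) / log 2 * (log 2 / (k - 1)) := by field_simp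
      _ ≤ _ := by gcongr; linarith
  have h2 : 2 / log 2 * (k : ℝ) ^ 2 + (2 - 3 / log 2) * k + 1 / log 2 =
      2 * k + (2 * k - 1) * ((k - 1) / log 2) := by
    field_simp
    ring
  rw [h2]
  nlinarith

theorem le_of_quadBound_le {n k : ℕ} (hk : 3 ≤ k) (h : quadBound k ≤ n) :
    2 * k ^ 2 + k ≤ n := by
  have hk' : (3 : ℝ) ≤ k := by exact_mod_cast hk
  have hl : 0 < log 2 := log_pos one_lt_two
  have h1 : 1.44 ≤ 1 / log 2 := by
    rw [le_div_iff₀ hl]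
    linarith [log_two_lt_d9]
  have h2 : quadBound k = 2 * k + (2 * k - 1) * (k - 1) * (1 / log 2) := by
    unfold quadBound
    ring
  have h3 : (2 * (k : ℝ) - 1) * (k - 1) * 1.44 ≤ (2 * k - 1) * (k - 1) * (1 / log 2) := by
    apply mul_le_mul_of_nonneg_left h1
    nlinarith
  -- Integrality of n is needed: for k = 3 the quadratic is about 20.4, while 2k² + k = 21.
  have h4 : ((2 * k ^ 2 + k : ℕ) : ℝ) < (n + 1 : ℕ) := by
    push_cast
    nlinarith
  exact Nat.lt_succ_iff.1 (by exact_mod_cast h4)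

end Bounds

end Toughness

theorem theorem1p3 :
    (∀ k : ℕ, 3 ≤ k → Toughness.rootBound k ≤ Toughness.quadBound k) ∧
    (∀ k n : ℕ, 5 ≤ k → Toughness.quadBound k ≤ (n : ℝ) →
      Toughness.toughness (Toughness.kneserGraph n k) = (n : ℝ) / (k : ℝ) - 1 ∧
      ∀ S : Finset {s : Finset (Fin n) // s.card = k},
        Toughness.IsVertexCut (Toughness.kneserGraph n k) S →
        Toughness.cutRatio (Toughness.kneserGraph n k) S =
          Toughness.toughness (Toughness.kneserGraph n k) →
        (Toughness.kneserGraph n k).IsMaximumIndepSet Sᶜ) ∧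
    (∀ k n : ℕ, 3 ≤ k → Toughness.quadBound k < (n : ℝ) →
      Toughness.toughness (Toughness.kneserGraph n k) = (n : ℝ) / (k : ℝ) - 1 ∧
      ∀ S : Finset {s : Finset (Fin n) // s.card = k},
        Toughness.IsVertexCut (Toughness.kneserGraph n k) S →
        Toughness.cutRatio (Toughness.kneserGraph n k) S = (n : ℝ) / (k : ℝ) - 1 →
        (Toughness.kneserGraph n k).IsMaximumIndepSet Sᶜ) := by
  refine ⟨fun k hk => Toughness.rootBound_le_quadBound (by omega), fun k n hk h => ?_,
    fun k n hk h => ?_⟩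
  · have ht := Toughness.toughness_kneserGraph (n := n) (k := k) (by omega)
      (Toughness.le_of_quadBound_le (by omega) h)
    exact ⟨ht.1, fun S hS hr => ht.2 S hS (hr.trans ht.1)⟩
  · exact Toughness.toughness_kneserGraph (by omega) (Toughness.le_of_quadBound_le hk h.le)
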